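/- Let $k$ be a perfect field and let $K=k(\!(t)\!)$ with the $t$-adic valuation $v_t$. Let $\mathfrak{L}_{\rm val}$ be the three-sorted language of valued fields, consisting of the language of rings on the field sort and on the residue field sort, the symbols $0,\infty,+,<$ on the value group sort (value group together with $\infty$), and function symbols for the valuation and for the residue map (extended by $0$ outside the valuation ring). Let $\mathfrak{L}_{\rm val}(k)$ be its expansion by a constant symbol of the field sort for every element of $k\subseteq K$. An existential formula is one obtained from quantifier-free formulas by conjunction, disjunction and existential quantification over variables of any of the three sorts. Then there is no surjective map $f\colon K\to K\times K$ for which there is an existential $\mathfrak{L}_{\rm val}(k)$-formula $\varphi(x,y_1,y_2)$, with free variables among the field-sort variables $x,y_1,y_2$, such that for all $x,y_1,y_2\in K$ $$f(x)=(y_1,y_2)\iff (K,v_t)\models\varphi(x,y_1,y_2).$$ -/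

import Mathlib

/-!
The usual three-sorted first-order language of valued fields, expanded by constants in the field
sort, its existential formulas, and the structure on a field of formal Laurent series.
-/

namespace ThreeSorted

universe u v w x

/-- The three sorts: the valued field, its residue field, and its value group with `∞`. -/
inductive VSort : Type
  | field
  | residue
  | value

/-- Terms of the field sort. The symbols are those of the language of rings, together with
a constant symbol for each `c : C`. Variables of each sort are indexed by `ℕ`. -/
inductive FieldTerm (C : Type u) : Type u
  | var (n : ℕ)
  | const (c : C)
  | zero
  | one
  | neg (a : FieldTerm C)
  | add (a b : FieldTerm C)
  | mul (a b : FieldTerm C)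

/-- Terms of the residue field sort: the language of rings and the residue map `res`. -/
inductive ResidueTerm (C : Type u) : Type u
  | var (n : ℕ)
  | zero
  | one
  | neg (a : ResidueTerm C)
  | add (a b : ResidueTerm C)
  | mul (a b : ResidueTerm C)
  | res (a : FieldTerm C)

/-- Terms of the value group sort: `0`, `∞`, `+` and the valuation map `val`. -/
inductive ValueTerm (C : Type u) : Type u
  | var (n : ℕ)
  | zero
  | infty
  | add (a b : ValueTerm C)
  | val (a : FieldTerm C)

/-- First-order formulas of the three-sorted language of valued fields with constants from `C`
in the field sort. In `ex s n φ` and `all s n φ`, the variable number `n` of sort `s` is bound. -/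
inductive Formula (C : Type u) : Type u
  | verum
  | falsum
  | eqField (a b : FieldTerm C)
  | eqResidue (a b : ResidueTerm C)
  | eqValue (a b : ValueTerm C)
  | ltValue (a b : ValueTerm C)
  | not (φ : Formula C)
  | and (φ ψ : Formula C)
  | or (φ ψ : Formula C)
  | ex (s : VSort) (n : ℕ) (φ : Formula C)
  | all (s : VSort) (n : ℕ) (φ : Formula C)

section Syntax_of_formulas

variable {C : Type u}

/-- The variables occurring in a term of the field sort. -/
def FieldTerm.vars : FieldTerm C → Set (VSort × ℕ)
  | .var n => {(VSort.field, n)}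
  | .const _ => ∅
  | .zero => ∅
  | .one => ∅
  | .neg a => a.vars
  | .add a b => a.vars ∪ b.vars
  | .mul a b => a.vars ∪ b.vars

/-- The variables occurring in a term of the residue field sort. -/
def ResidueTerm.vars : ResidueTerm C → Set (VSort × ℕ)
  | .var n => {(VSort.residue, n)}
  | .zero => ∅
  | .one => ∅
  | .neg a => a.vars
  | .add a b => a.vars ∪ b.vars
  | .mul a b => a.vars ∪ b.vars
  | .res a => a.vars

/-- The variables occurring in a term of the value group sort. -/
def ValueTerm.vars : ValueTerm C → Set (VSort × ℕ)
  | .var n => {(VSort.value, n)}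
  | .zero => ∅
  | .infty => ∅
  | .add a b => a.vars ∪ b.vars
  | .val a => a.vars

/-- The free variables of a formula. -/
def Formula.freeVars : Formula C → Set (VSort × ℕ)
  | .verum => ∅
  | .falsum => ∅
  | .eqField a b => a.vars ∪ b.vars
  | .eqResidue a b => a.vars ∪ b.vars
  | .eqValue a b => a.vars ∪ b.vars
  | .ltValue a b => a.vars ∪ b.vars
  | .not φ => φ.freeVars
  | .and φ ψ => φ.freeVars ∪ ψ.freeVars
  | .or φ ψ => φ.freeVars ∪ ψ.freeVars
  | .ex s n φ => φ.freeVars \ {(s, n)}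
  | .all s n φ => φ.freeVars \ {(s, n)}

/-- Quantifier-free formulas. -/
def Formula.IsQuantifierFree : Formula C → Prop
  | .verum => True
  | .falsum => True
  | .eqField _ _ => True
  | .eqResidue _ _ => True
  | .eqValue _ _ => True
  | .ltValue _ _ => True
  | .not φ => φ.IsQuantifierFree
  | .and φ ψ => φ.IsQuantifierFree ∧ ψ.IsQuantifierFree
  | .or φ ψ => φ.IsQuantifierFree ∧ ψ.IsQuantifierFree
  | .ex _ _ _ => False
  | .all _ _ _ => False

/-- Existential formulas: the smallest set of formulas that contains the quantifier-free ones and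
is closed under conjunction, disjunction and existential quantification over any sort. -/
inductive Formula.IsExistential : Formula C → Prop
  | quantifierFree {φ : Formula C} (h : φ.IsQuantifierFree) : IsExistential φ
  | and {φ ψ : Formula C} (hφ : IsExistential φ) (hψ : IsExistential ψ) :
      IsExistential (.and φ ψ)
  | or {φ ψ : Formula C} (hφ : IsExistential φ) (hψ : IsExistential ψ) :
      IsExistential (.or φ ψ)
  | ex (s : VSort) (n : ℕ) {φ : Formula C} (hφ : IsExistential φ) : IsExistential (.ex s n φ)

end Syntax_of_formulas

/-- Interpretations of the symbols `val`, `res` and of the constants from `C`, on carriers `K`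
(field sort), `R` (residue field sort), `G` (value group with `∞`). The remaining symbols are
interpreted by the operations that `K`, `R` and `G` carry. -/
structure Interpretation (C : Type u) (K : Type v) (R : Type w) (G : Type x) where
  val : K → G
  res : K → R
  const : C → K

/-- Assignments of values to the variables of the three sorts. -/
structure Assignment (K : Type v) (R : Type w) (G : Type x) where
  field : ℕ → K
  residue : ℕ → R
  value : ℕ → G

section Semantics

variable {C : Type u} {K : Type v} {R : Type w} {G : Type x}

/-- Change the value of the field variable `n` to `a`. -/
def Assignment.updateField (ρ : Assignment K R G) (n : ℕ) (a : K) : Assignment K R G :=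
  { ρ with field := Function.update ρ.field n a }

/-- Change the value of the residue field variable `n` to `a`. -/
def Assignment.updateResidue (ρ : Assignment K R G) (n : ℕ) (a : R) : Assignment K R G :=
  { ρ with residue := Function.update ρ.residue n a }

/-- Change the value of the value group variable `n` to `a`. -/
def Assignment.updateValue (ρ : Assignment K R G) (n : ℕ) (a : G) : Assignment K R G :=
  { ρ with value := Function.update ρ.value n a }

variable [Ring K] [Ring R] [AddMonoid G] [Top G] [LT G]

/-- The value of a term of the field sort. -/
def FieldTerm.eval (M : Interpretation C K R G) (ρ : Assignment K R G) : FieldTerm C → K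
  | .var n => ρ.field n
  | .const c => M.const c
  | .zero => 0
  | .one => 1
  | .neg a => -(a.eval M ρ)
  | .add a b => a.eval M ρ + b.eval M ρ
  | .mul a b => a.eval M ρ * b.eval M ρ

/-- The value of a term of the residue field sort. -/
def ResidueTerm.eval (M : Interpretation C K R G) (ρ : Assignment K R G) : ResidueTerm C → R
  | .var n => ρ.residue n
  | .zero => 0
  | .one => 1
  | .neg a => -(a.eval M ρ)
  | .add a b => a.eval M ρ + b.eval M ρ
  | .mul a b => a.eval M ρ * b.eval M ρ
  | .res a => M.res (a.eval M ρ)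

/-- The value of a term of the value group sort. -/
def ValueTerm.eval (M : Interpretation C K R G) (ρ : Assignment K R G) : ValueTerm C → G
  | .var n => ρ.value n
  | .zero => 0
  | .infty => ⊤
  | .add a b => a.eval M ρ + b.eval M ρ
  | .val a => M.val (a.eval M ρ)

/-- Truth of a formula under an assignment. -/
def Formula.Realize (M : Interpretation C K R G) : Formula C → Assignment K R G → Prop
  | .verum, _ => True
  | .falsum, _ => False
  | .eqField a b, ρ => a.eval M ρ = b.eval M ρ
  | .eqResidue a b, ρ => a.eval M ρ = b.eval M ρ
  | .eqValue a b, ρ => a.eval M ρ = b.eval M ρ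
  | .ltValue a b, ρ => a.eval M ρ < b.eval M ρ
  | .not φ, ρ => ¬ φ.Realize M ρ
  | .and φ ψ, ρ => φ.Realize M ρ ∧ ψ.Realize M ρ
  | .or φ ψ, ρ => φ.Realize M ρ ∨ ψ.Realize M ρ
  | .ex .field n φ, ρ => ∃ a : K, φ.Realize M (ρ.updateField n a)
  | .ex .residue n φ, ρ => ∃ a : R, φ.Realize M (ρ.updateResidue n a)
  | .ex .value n φ, ρ => ∃ a : G, φ.Realize M (ρ.updateValue n a)
  | .all .field n φ, ρ => ∀ a : K, φ.Realize M (ρ.updateField n a)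
  | .all .residue n φ, ρ => ∀ a : R, φ.Realize M (ρ.updateResidue n a)
  | .all .value n φ, ρ => ∀ a : G, φ.Realize M (ρ.updateValue n a)

end Semantics

open Classical in
/-- The valued field `k((t))` with its `t`-adic valuation: the residue field is `k`, the value
group with `∞` is `ℤ ∪ {∞}`, the residue map takes a series in `k[[t]]` to its constant
coefficient and (as usual) every other series to `0`, and each `c : k` names the constant
series `c`. -/
noncomputable def laurent (k : Type u) [Field k] :
    Interpretation k (LaurentSeries k) k (WithTop ℤ) where
  val f := HahnSeries.addVal ℤ k f
  res f := if 0 ≤ HahnSeries.addVal ℤ k f then f.coeff 0 else 0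
  const c := HahnSeries.C c

/-- The map `f : k((t)) → k((t)) × k((t))` is definable by an existential formula `φ(x, y₁, y₂)`,
with constants from `k`, of the language of valued fields; the free variables `x`, `y₁`, `y₂` are
the variables `0`, `1`, `2` of the field sort. -/
def IsExistentiallyDefinable {k : Type u} [Field k]
    (f : LaurentSeries k → LaurentSeries k × LaurentSeries k) : Prop :=
  ∃ φ : Formula k, φ.IsExistential ∧
    φ.freeVars ⊆ {(VSort.field, 0), (VSort.field, 1), (VSort.field, 2)} ∧
    ∀ ρ : Assignment (LaurentSeries k) k (WithTop ℤ),
      φ.Realize (laurent k) ρ ↔ f (ρ.field 0) = (ρ.field 1, ρ.field 2)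

end ThreeSorted

open Filter Topology Polynomial

/-! ### Convergence in k((t)) and local constancy of the valuation -/

namespace LaurentSeries

variable {k : Type*} [Field k]

/-! Existential formulas survive infinitesimal perturbation of their variables, while one parameter
cannot pin down two algebraically independent elements.

Suppose f(x) = (t, y), where y = ∑ t^(n!) is transcendental over k(t). Write x ∈ k(x₀) with x₀ not a
p-th power (`exists_mem_adjoin_simple_forall_pow_ne`). As k(x₀) has transcendence degree at most 1
over k, some w ∈ {t, y} is transcendental over it. Let L ⊆ K be generated over k(x₀) by t, y and the
finitely many field-sort witnesses of φ(x, t, y). Since k is perfect and x₀ is not a p-th power,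
MacLane's criterion makes L separably generated over k(x₀).

Hensel's lemma then yields an embedding τ of L in an ultrapower of K, infinitesimally close to the
inclusion, fixing k(x₀) but moving w (`exists_near_hom_moving`). Valuations of nonzero elements and
residues are locally constant, and τ is injective, so τ preserves the truth of quantifier-free
formulas. Hence φ(x, uₙ, vₙ) holds for almost all n, where (uₙ), (vₙ) represent τ t, τ y
(`Formula.IsExistential.exists_finite_witnesses`). As φ defines a function, uₙ = t and vₙ = y for
almost all n, so τ fixes w: a contradiction. -/

theorem tendsto_iff_coeff {ι : Type*} {l : Filter ι} {u : ι → LaurentSeries k}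
    {a : LaurentSeries k} :
    Tendsto u l (𝓝 a) ↔ ∀ D : ℤ, ∀ᶠ i in l, ∀ n < D, (u i).coeff n = a.coeff n := by
  have key : ∀ (D : ℤ) (z : LaurentSeries k), Valued.v (z - a) ≤ WithZero.exp (-D) ↔
      ∀ n < D, z.coeff n = a.coeff n := fun D z => by
    rw [valuation_le_iff_coeff_lt_eq_zero]
    simp [sub_eq_zero]
  constructor
  · intro h D
    have hx : Valued.v (HahnSeries.single D (1 : k) : LaurentSeries k) = WithZero.exp (-D) :=
      valuation_single_zpow k D
    -- The valuation is locally constant only away from 0, so the difference is translated to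
    -- converge to t^D, whose valuation is exactly the bound wanted.
    have h1 : Tendsto (fun i => u i - a + HahnSeries.single D (1 : k)) l
        (𝓝 (HahnSeries.single D (1 : k) : LaurentSeries k)) := by
      simpa using (h.sub_const a).add_const (HahnSeries.single D (1 : k) : LaurentSeries k)
    have h2 := h1.eventually (Valued.locally_const (x := (HahnSeries.single D (1 : k) :
      LaurentSeries k)) (by rw [hx]; exact WithZero.exp_ne_zero))
    filter_upwards [h2] with i hi
    rw [← key]
    have : u i - a = (u i - a + HahnSeries.single D (1 : k)) - HahnSeries.single D (1 : k) := by
      ring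
    rw [this]
    refine (Valuation.map_sub _ _ _).trans ?_
    rw [hi, hx, max_self]
  · intro h U hU
    obtain ⟨γ, hγ⟩ := Valued.mem_nhds.mp hU
    set D := -(WithZero.log (MonoidWithZeroHom.ValueGroup₀.embedding γ.1) - 1) with hD₀
    have hD : WithZero.exp (-D) < MonoidWithZeroHom.ValueGroup₀.embedding γ.1 := by
      rw [← WithZero.lt_log_iff_exp_lt (by simp), hD₀]
      simp
    rw [mem_map]
    filter_upwards [h D] with i hi
    refine hγ ?_
    simp only [Set.mem_ofPred_eq, Valued.v.restrict_lt_iff_lt_embedding]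
    exact lt_of_le_of_lt ((key D _).2 hi) hD

theorem tendsto_add_X_pow (a : LaurentSeries k) :
    Tendsto (fun n : ℕ => a + HahnSeries.single (n : ℤ) 1) atTop (𝓝 a) := by
  rw [tendsto_iff_coeff]
  intro D
  filter_upwards [eventually_ge_atTop D.toNat] with n hn m hm
  rw [HahnSeries.coeff_add, HahnSeries.coeff_single_of_ne (by omega), add_zero]

theorem eventually_orderTop_eq {ι : Type*} {l : Filter ι} {u : ι → LaurentSeries k}
    {a : LaurentSeries k} (h : Tendsto u l (𝓝 a)) (ha : a ≠ 0) :
    ∀ᶠ i in l, (u i).orderTop = a.orderTop := by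
  obtain ⟨d, hd⟩ : ∃ d : ℤ, a.orderTop = d :=
    ⟨a.order, (HahnSeries.order_eq_orderTop_of_ne_zero ha).symm⟩
  filter_upwards [tendsto_iff_coeff.1 h (d + 1)] with i hi
  rw [hd]
  refine le_antisymm ?_ ?_
  · refine HahnSeries.orderTop_le_of_coeff_ne_zero ?_
    rw [hi d (by omega)]
    exact HahnSeries.coeff_orderTop_ne hd
  · rw [HahnSeries.le_orderTop_iff_forall]
    intro j hj
    have hj' : j < d := by exact_mod_cast hj
    rw [hi j (by omega)]
    exact HahnSeries.coeff_eq_zero_of_lt_orderTop (hd ▸ hj)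

/-- Only the coefficients of negative index matter, so unlike equality of orders this persists at a
= 0. -/
theorem eventually_orderTop_nonneg_iff {ι : Type*} {l : Filter ι} {u : ι → LaurentSeries k}
    {a : LaurentSeries k} (h : Tendsto u l (𝓝 a)) :
    ∀ᶠ i in l, (0 ≤ (u i).orderTop ↔ 0 ≤ a.orderTop) := by
  filter_upwards [tendsto_iff_coeff.1 h 0] with i hi
  rw [HahnSeries.le_orderTop_iff_forall, HahnSeries.le_orderTop_iff_forall]
  refine forall₂_congr fun j hj => ?_
  rw [hi j (by exact_mod_cast hj)]

theorem exists_powerSeries_of_coeff_eq_zero {a : LaurentSeries k}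
    (h : ∀ n < (1 : ℤ), a.coeff n = 0) :
    ∃ F : PowerSeries k, PowerSeries.X ∣ F ∧ (F : LaurentSeries k) = a := by
  obtain ⟨F, rfl⟩ := (val_le_one_iff_eq_coe k a).1 (by
    have := (valuation_le_iff_coeff_lt_eq_zero k (D := 0) (f := a)).2 fun n hn => h n (by omega)
    simpa using this)
  refine ⟨F, ?_, rfl⟩
  rw [PowerSeries.X_dvd_iff, ← PowerSeries.coeff_zero_eq_constantCoeff_apply,
    ← coeff_coe_powerSeries]
  exact h 0 (by norm_num)

/-- The factors from k[[t]] have valuation at most 1, so they need not converge: Hensel roots chosen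
separately for each index can be used. -/
theorem tendsto_zero_mul_powerSeries {ι : Type*} {l : Filter ι} {u : ι → LaurentSeries k}
    (h : Tendsto u l (𝓝 0)) (F : ι → PowerSeries k) :
    Tendsto (fun i => u i * (F i : LaurentSeries k)) l (𝓝 0) := by
  rw [tendsto_iff_coeff] at h ⊢
  intro D
  filter_upwards [h D] with i hi
  have hF := (val_le_one_iff_eq_coe k _).2 ⟨F i, rfl⟩
  have hu := (valuation_le_iff_coeff_lt_eq_zero k).2 hi
  refine (valuation_le_iff_coeff_lt_eq_zero k).1 ?_
  rw [map_mul]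
  simpa using mul_le_mul' hu hF

end LaurentSeries

/-! ### A normalised form of Hensel's lemma -/

namespace PowerSeries

variable {k : Type*} [Field k]

/-- Hensel's lemma at the root `-1` of `1 + z` modulo `X`. -/
theorem exists_one_add_add_sum_eq_zero (d : ℕ) (e : ℕ → PowerSeries k)
    (he : ∀ j, (X : PowerSeries k) ∣ e j) :
    ∃ z : PowerSeries k, 1 + z + ∑ j ∈ Finset.range d, e j * z ^ (j + 2) = 0 := by
  set I : Ideal (PowerSeries k) := Ideal.span {X} with hI
  set s : Polynomial (PowerSeries k) :=
    ∑ j ∈ Finset.range d, Polynomial.C (e j) * Polynomial.X ^ (d - 1 - j) with hs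
  -- The reversed equation, with root w = 1/z: it is monic and reduces to X^d (X + 1), where -1 is a
  -- simple root.
  set f : Polynomial (PowerSeries k) := Polynomial.X ^ (d + 1) + (Polynomial.X ^ d + s) with hf
  have hsdeg : s.degree ≤ d := by
    refine (degree_sum_le _ _).trans (Finset.sup_le fun j hj => ?_)
    refine (degree_C_mul_X_pow_le _ _).trans ?_
    exact_mod_cast (by omega : d - 1 - j ≤ d)
  have hmonic : f.Monic := by
    refine monic_X_pow_add ?_
    refine ((degree_add_le _ _).trans (max_le (degree_X_pow_le d) hsdeg)).trans_lt ?_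
    exact_mod_cast Nat.lt_succ_self d
  have hmap : f.map (Ideal.Quotient.mk I) = Polynomial.X ^ d * (Polynomial.X + 1) := by
    have : s.map (Ideal.Quotient.mk I) = 0 := by
      rw [hs, Polynomial.map_sum]
      refine Finset.sum_eq_zero fun j _ => ?_
      have : Ideal.Quotient.mk I (e j) = 0 :=
        Ideal.Quotient.eq_zero_iff_mem.2 (Ideal.mem_span_singleton.2 (he j))
      simp [this]
    rw [hf]
    simp [this]
    ring
  obtain ⟨w, hw, hwI⟩ := HenselianRing.is_henselian (I := I) f hmonic (-1) (by
      rw [← Ideal.Quotient.eq_zero_iff_mem, ← Polynomial.eval_map_apply, hmap]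
      simp) (by
      rw [← Polynomial.eval_map_apply, ← Polynomial.derivative_map, hmap]
      simpa using ((isUnit_one (M := PowerSeries k ⧸ I)).neg).pow d)
  have hwu : IsUnit w := by
    rw [PowerSeries.isUnit_iff_constantCoeff]
    obtain ⟨c, hc⟩ := Ideal.mem_span_singleton.1 hwI
    have : w = -1 + X * c := by rw [← hc]; ring
    rw [this]
    simp
  obtain ⟨u, rfl⟩ := hwu
  refine ⟨((u⁻¹ : (PowerSeries k)ˣ) : PowerSeries k), ?_⟩
  refine (u.isUnit.pow (d + 1)).mul_right_cancel ?_
  rw [zero_mul, ← show f.eval (u : PowerSeries k) = 0 from hw, hf, hs]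
  simp only [eval_add, eval_pow, eval_X, eval_finsetSum, eval_mul, eval_C, add_mul, one_mul,
    Finset.sum_mul]
  rw [add_assoc]
  congr 2
  · rw [pow_succ' _ d, ← mul_assoc, Units.inv_mul, one_mul]
  · refine Finset.sum_congr rfl fun j hj => ?_
    have : d + 1 = (j + 2) + (d - 1 - j) := by have := Finset.mem_range.1 hj; omega
    rw [this, pow_add _ (j + 2) (d - 1 - j), ← mul_assoc, mul_assoc (e j), ← mul_pow,
        Units.inv_mul, one_pow, mul_one]

end PowerSeries

/-! ### Continuity of simple roots -/

namespace LaurentSeries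

variable {k : Type*} [Field k]

/-- Simple roots of polynomials over `k((t))` depend continuously on the coefficients. -/
theorem exists_tendsto_root {ι : Type*} {l : Filter ι} {d : ℕ}
    {f : ι → (LaurentSeries k)[X]} {g : (LaurentSeries k)[X]}
    (hf : ∀ i, (f i).natDegree < d + 2) (hg : g.natDegree < d + 2)
    (hfg : ∀ j, Tendsto (fun i => (f i).coeff j) l (𝓝 (g.coeff j))) {c : LaurentSeries k}
    (hc : g.eval c = 0) (hc' : g.derivative.eval c ≠ 0) :
    ∃ u : ι → LaurentSeries k, Tendsto u l (𝓝 c) ∧ ∀ᶠ i in l, (f i).eval (u i) = 0 := by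
  set h : ι → (LaurentSeries k)[X] := fun i => taylor c (f i) with hh
  have hcoeff : ∀ j, Tendsto (fun i => (h i).coeff j) l (𝓝 ((taylor c g).coeff j)) := by
    intro j
    simp only [hh, taylor_coeff]
    -- The common degree bound makes every Taylor coefficient one fixed finite expression in the
    -- coefficients, hence continuous in them.
    have key : ∀ p : (LaurentSeries k)[X],
        p.natDegree < d + 2 → eval c (Polynomial.hasseDeriv j p) =
        ∑ i ∈ Finset.range (d + 2),
          ((i + j).choose j : LaurentSeries k) * p.coeff (i + j) * c ^ i := by
      intro p hp
      rw [eval_eq_sum_range' (n := d + 2)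
        ((natDegree_hasseDeriv_le p j).trans_lt (lt_of_le_of_lt (Nat.sub_le _ _) hp))]
      simp [Polynomial.hasseDeriv_coeff]
    rw [key g hg]
    refine Tendsto.congr (fun i => (key (f i) (hf i)).symm) ?_
    exact tendsto_finsetSum _ fun i _ => ((hfg (i + j)).const_mul _).mul_const _
  have h0 : (taylor c g).coeff 0 = 0 := by rw [taylor_coeff_zero, hc]
  have h1 : (taylor c g).coeff 1 ≠ 0 := by rwa [taylor_coeff_one]
  -- The Newton step up to sign. Substituting c + γz and factoring out the constant term leaves 1 +
  -- z + ∑ eⱼ z^(j+2) with eⱼ → 0, so eventually t divides every eⱼ.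
  set γ : ι → LaurentSeries k := fun i => (h i).coeff 0 / (h i).coeff 1 with hγ
  have hγ0 : Tendsto γ l (𝓝 0) := by
    have := (hcoeff 0).div (hcoeff 1) h1
    rwa [h0, zero_div] at this
  have he : ∀ j, Tendsto (fun i => (h i).coeff (j + 2) * γ i ^ (j + 1) / (h i).coeff 1) l
      (𝓝 0) := by
    intro j
    have := ((hcoeff (j + 2)).mul (hγ0.pow (j + 1))).div (hcoeff 1) h1
    rwa [zero_pow (Nat.succ_ne_zero j), mul_zero, zero_div] at this
  have hev : ∀ᶠ i in l, ∃ z : PowerSeries k, (f i).eval (c + γ i * z) = 0 := by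
    have h3 : ∀ᶠ i in l, ∀ j ∈ Finset.range d, ∀ n < (1 : ℤ),
        ((h i).coeff (j + 2) * γ i ^ (j + 1) / (h i).coeff 1).coeff n = 0 := by
      rw [eventually_all_finset]
      exact fun j _ => tendsto_iff_coeff.1 (he j) 1
    filter_upwards [h3, (hcoeff 1).eventually_ne h1] with i hi hi1
    choose! F hFX hF using fun j hj => exists_powerSeries_of_coeff_eq_zero (hi j hj)
    obtain ⟨z, hz⟩ := PowerSeries.exists_one_add_add_sum_eq_zero d
      (fun j => if j ∈ Finset.range d then F j else 0) (fun j => by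
        split_ifs with hj
        · exact hFX j hj
        · exact dvd_zero _)
    refine ⟨z, ?_⟩
    have hz' := congrArg (HahnSeries.ofPowerSeries ℤ k) hz
    simp only [map_add, map_one, map_sum, map_mul, map_pow, map_zero] at hz'
    have hβ : γ i * (h i).coeff 1 = (h i).coeff 0 := div_mul_cancel₀ _ hi1
    have : (f i).eval (c + γ i * z) = (h i).eval (γ i * z) := by
      rw [hh, taylor_eval, add_comm]
    rw [this, eval_eq_sum_range' (n := d + 2) (by rw [hh, natDegree_taylor]; exact hf i),
      Finset.sum_range_succ', Finset.sum_range_succ']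
    trans (h i).coeff 0 * (1 + (z : LaurentSeries k) + ∑ j ∈ Finset.range d,
      HahnSeries.ofPowerSeries ℤ k (if j ∈ Finset.range d then F j else 0) *
        (z : LaurentSeries k) ^ (j + 2))
    · rw [mul_add, mul_add, Finset.mul_sum, mul_one]
      rw [← hβ]
      have : ∀ j ∈ Finset.range d, (h i).coeff (j + 1 + 1) * (γ i * z) ^ (j + 1 + 1) =
        γ i * (h i).coeff 1 * (HahnSeries.ofPowerSeries ℤ k
          (if j ∈ Finset.range d then F j else 0) * (z : LaurentSeries k) ^ (j + 2)) := by
        intro j hj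
        rw [if_pos hj, hF j hj]
        field_simp
        ring
      rw [Finset.sum_congr rfl this]
      ring
    · rw [hz', mul_zero]
  have hev' : ∀ i, ∃ z : PowerSeries k, (∃ w : PowerSeries k, (f i).eval (c + γ i * w) = 0) →
      (f i).eval (c + γ i * z) = 0 := fun i => by
    by_cases hw : ∃ w : PowerSeries k, (f i).eval (c + γ i * w) = 0
    · exact ⟨hw.choose, fun _ => hw.choose_spec⟩
    · exact ⟨0, fun h => absurd h hw⟩
  choose z hz using hev'
  refine ⟨fun i => c + γ i * z i, ?_, hev.mono hz⟩
  simpa using (tendsto_zero_mul_powerSeries hγ0 z).const_add c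

end LaurentSeries

/-! ### The ultrapower and infinitesimal perturbations of embeddings -/

namespace LaurentSeries

variable {k : Type*} [Field k]

variable (k) in
/-- The ultrapower of `k((t))` along a nonprincipal ultrafilter on `ℕ`. -/
abbrev Ultra : Type _ := Germ (hyperfilter ℕ : Filter ℕ) (LaurentSeries k)

variable (k) in
/-- The diagonal embedding of `k((t))` into its ultrapower. -/
noncomputable def diag : LaurentSeries k →+* Ultra k :=
  (Germ.coeRingHom _).comp (Pi.constRingHom ℕ (LaurentSeries k))

theorem diag_apply (a : LaurentSeries k) :
    diag k a = ((fun _ => a : ℕ → LaurentSeries k) : Ultra k) :=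
  rfl

/-- `g` is infinitesimally close to the standard element `a`. -/
def Near (g : Ultra k) (a : LaurentSeries k) : Prop := g.Tendsto (𝓝 a)

theorem near_coe {u : ℕ → LaurentSeries k} {a : LaurentSeries k} :
    Near (u : Ultra k) a ↔ Tendsto u (hyperfilter ℕ) (𝓝 a) := Iff.rfl

theorem near_diag (a : LaurentSeries k) : Near (diag k a) a :=
  near_coe.2 tendsto_const_nhds

theorem Near.add {g h : Ultra k} {a b : LaurentSeries k} (hg : Near g a) (hh : Near h b) :
    Near (g + h) (a + b) := by
  induction g using Germ.inductionOn with | _ u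
  induction h using Germ.inductionOn with | _ v
  exact near_coe.2 (Tendsto.add (near_coe.1 hg) (near_coe.1 hh))

theorem Near.mul {g h : Ultra k} {a b : LaurentSeries k} (hg : Near g a) (hh : Near h b) :
    Near (g * h) (a * b) := by
  induction g using Germ.inductionOn with | _ u
  induction h using Germ.inductionOn with | _ v
  exact near_coe.2 (Tendsto.mul (near_coe.1 hg) (near_coe.1 hh))

theorem Near.div {g h : Ultra k} {a b : LaurentSeries k} (hg : Near g a) (hh : Near h b)
    (hb : b ≠ 0) : Near (g / h) (a / b) := by
  induction g using Germ.inductionOn with | _ u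
  induction h using Germ.inductionOn with | _ v
  exact near_coe.2 (Tendsto.div (near_coe.1 hg) (near_coe.1 hh) hb)

theorem Near.unique {g : Ultra k} {a b : LaurentSeries k} (ha : Near g a) (hb : Near g b) :
    a = b := by
  induction g using Germ.inductionOn with | _ u
  exact tendsto_nhds_unique (near_coe.1 ha) (near_coe.1 hb)

theorem Near.eval₂ {A : Type*} [CommRing A] {σ : A →+* Ultra k} {j : A →+* LaurentSeries k}
    (h : ∀ a, Near (σ a) (j a)) {ζ : Ultra k} {c : LaurentSeries k} (hζ : Near ζ c) (p : A[X]) :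
    Near (p.eval₂ σ ζ) (p.eval₂ j c) := by
  induction p using Polynomial.induction_on with
  | C a => simpa using h a
  | add p q hp hq => simpa using hp.add hq
  | monomial n a ih =>
    rw [pow_succ, ← mul_assoc, eval₂_mul (p := C a * X ^ n), eval₂_X,
      eval₂_mul (p := C a * X ^ n), eval₂_X]
    exact ih.mul hζ

theorem exists_near_root {f : (Ultra k)[X]} {g : (LaurentSeries k)[X]}
    (hfg : ∀ j, Near (f.coeff j) (g.coeff j)) {c : LaurentSeries k}
    (hc : g.eval c = 0) (hc' : g.derivative.eval c ≠ 0) :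
    ∃ ζ : Ultra k, f.eval ζ = 0 ∧ Near ζ c := by
  have hr : ∀ j, ∃ r : ℕ → LaurentSeries k, (r : Ultra k) = f.coeff j := fun j =>
    Quotient.exists_rep (f.coeff j)
  choose r hr using hr
  set d := max f.natDegree g.natDegree
  have hfd : f.natDegree < d + 2 := lt_of_le_of_lt (le_max_left _ _) (by omega : d < d + 2)
  have hgd : g.natDegree < d + 2 := lt_of_le_of_lt (le_max_right _ _) (by omega : d < d + 2)
  -- Representatives of the coefficient germs, assembled into honest polynomials of uniformly
  -- bounded degree.
  set F : ℕ → (LaurentSeries k)[X] := fun n =>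
    ∑ i ∈ Finset.range (d + 2), C (r i n) * X ^ i with hF
  obtain ⟨u, hu, hu0⟩ := exists_tendsto_root (l := (hyperfilter ℕ : Filter ℕ)) (d := d) (f := F)
    (g := g) (fun n => by
      refine Nat.lt_succ_of_le (natDegree_sum_le_of_forall_le _ _ fun i hi => ?_)
      exact (natDegree_C_mul_X_pow_le _ _).trans (Nat.le_of_lt_succ (Finset.mem_range.1 hi))) hgd
          (fun j => by
      have hFj : ∀ n, (F n).coeff j = if j < d + 2 then r j n else 0 := fun n => by
        simp [hF, finsetSum_coeff, coeff_C_mul, coeff_X_pow]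
      simp only [hFj]
      split_ifs with hj
      · rw [← near_coe, hr]
        exact hfg j
      · rw [coeff_eq_zero_of_natDegree_lt (hgd.trans_le (not_lt.1 hj))]
        exact tendsto_const_nhds) hc hc'
  refine ⟨(u : Ultra k), ?_, near_coe.2 hu⟩
  rw [eval_eq_sum_range' hfd]
  have : ∑ i ∈ Finset.range (d + 2), f.coeff i * (u : Ultra k) ^ i =
      Germ.coeRingHom _ (fun n => (F n).eval (u n)) := by
    have h1 : (fun n => (F n).eval (u n)) = ∑ i ∈ Finset.range (d + 2), r i * u ^ i := by
      ext1 n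
      simp [hF, eval_finsetSum]
    rw [h1, map_sum]
    refine Finset.sum_congr rfl fun i _ => ?_
    rw [map_mul, map_pow, ← hr]
    rfl
  rw [this]
  exact Germ.coe_eq.2 hu0

variable {M L : Type*} [Field M] [Field L] [Algebra M L]

open IntermediateField

/-- Sending b to β is injective on M[X]: if p goes to 0, then j(p(b)) is infinitesimally close to 0,
hence is 0, against transcendence of b. So the map extends to fractions, and closeness passes to
quotients. -/
theorem exists_near_hom_adjoin_simple (j : L →+* LaurentSeries k) {b : L}
    (hb : Transcendental M b) {β : Ultra k} (hβ : Near β (j b)) :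
    ∃ σ : M⟮b⟯ →+* Ultra k, (∀ m : M, σ (algebraMap M M⟮b⟯ m) = diag k (j (algebraMap M L m))) ∧
      σ (AdjoinSimple.gen M b) = β ∧ ∀ w : M⟮b⟯, Near (σ w) (j w) := by
  set φ : M[X] →+* Ultra k := eval₂RingHom ((diag k).comp (j.comp (algebraMap M L))) β with hφ
  have hφn : ∀ p, Near (φ p) (j (aeval b p)) := fun p => by
    have := Near.eval₂ (σ := (diag k).comp (j.comp (algebraMap M L)))
      (j := j.comp (algebraMap M L)) (fun a => near_diag _) hβ p
    rwa [← hom_eval₂] at this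
  have hinj : Function.Injective φ := by
    rw [injective_iff_map_eq_zero]
    intro p hp
    have h1 := hφn p
    rw [hp] at h1
    have h2 := h1.unique (by simpa using near_diag (0 : LaurentSeries k))
    exact (transcendental_iff.1 hb) p (by simpa using h2)
  set e := RatFunc.algEquivOfTranscendental b hb
  set lift : RatFunc M →+* Ultra k := IsFractionRing.lift (K := RatFunc M) hinj
  have hlift : ∀ p : M[X], lift (algebraMap _ _ p) = φ p := fun p =>
    IsFractionRing.lift_algebraMap hinj p
  have hcoe : ∀ p : M[X], ((e (algebraMap M[X] (RatFunc M) p) : M⟮b⟯) : L) = aeval b p := by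
    intro p
    rw [RatFunc.algEquivOfTranscendental_algebraMap]
    simp
  refine ⟨lift.comp (e.symm : M⟮b⟯ →+* RatFunc M), ?_, ?_, ?_⟩
  · intro m
    have : e.symm (algebraMap M M⟮b⟯ m) = algebraMap M[X] (RatFunc M) (C m) := by
      rw [AlgEquiv.commutes, RatFunc.algebraMap_C]; rfl
    simp only [RingHom.comp_apply, RingHom.coe_coe]
    rw [this, hlift]
    simp [hφ]
  · simp only [RingHom.comp_apply, RingHom.coe_coe]
    rw [RatFunc.algEquivOfTranscendental_symm_gen, ← RatFunc.algebraMap_X, hlift]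
    simp [hφ]
  · intro w
    obtain ⟨r, rfl⟩ := e.surjective w
    simp only [RingHom.comp_apply, RingHom.coe_coe, AlgEquiv.symm_apply_apply]
    induction r using RatFunc.induction_on with | _ p q hq
    have hq' : j (aeval b q) ≠ 0 := by
      simpa using fun h => hq ((transcendental_iff.1 hb) q h)
    rw [map_div₀, hlift, hlift, map_div₀, IntermediateField.coe_div, hcoe, hcoe, map_div₀]
    exact (hφn p).div (hφn q) hq'

/-- If `L` is finite separable over `M(b)` with `b` transcendental over `M`, an embedding of `L`
in `k((t))` can be perturbed infinitesimally, fixing `M` and moving `b` at will. -/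
theorem exists_near_hom (j : L →+* LaurentSeries k) {b : L}
    (hb : Transcendental M b) {β : Ultra k} (hβ : Near β (j b))
    [FiniteDimensional M⟮b⟯ L] [Algebra.IsSeparable M⟮b⟯ L] :
    ∃ τ : L →+* Ultra k, (∀ m : M, τ (algebraMap M L m) = diag k (j (algebraMap M L m))) ∧
      τ b = β ∧ ∀ w : L, Near (τ w) (j w) := by
  obtain ⟨σ, hσM, hσb, hσ⟩ := exists_near_hom_adjoin_simple j hb hβ
  let pb := Field.powerBasisOfFiniteOfSeparable M⟮b⟯ L
  set P := minpoly M⟮b⟯ pb.gen with hP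
  set i : M⟮b⟯ →+* LaurentSeries k := j.comp (algebraMap M⟮b⟯ L) with hi
  have hint : IsIntegral M⟮b⟯ pb.gen := Algebra.IsIntegral.isIntegral _
  have hsep : P.Separable := Algebra.IsSeparable.isSeparable M⟮b⟯ pb.gen
  -- Separability makes the primitive element a simple root of its minimal polynomial; transporting
  -- the coefficients by σ moves that root only infinitesimally.
  obtain ⟨ζ, hζ0, hζ⟩ := exists_near_root (f := P.map σ) (g := P.map i) (c := j pb.gen)
    (fun n => by rw [coeff_map, coeff_map]; exact hσ _)
    (by rw [eval_map, hi, ← hom_eval₂, ← aeval_def, minpoly.aeval, map_zero])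
    (by
      rw [derivative_map, eval_map, hi, ← hom_eval₂, ← aeval_def]
      exact (map_ne_zero j).2 (hsep.aeval_derivative_ne_zero (minpoly.aeval _ _)))
  let := σ.toAlgebra
  have hζ0' : aeval ζ (minpoly M⟮b⟯ pb.gen) = 0 := by
    rw [eval_map] at hζ0
    exact hζ0
  set τ := pb.lift ζ hζ0'
  have hτ : ∀ w : M⟮b⟯, τ (algebraMap _ L w) = σ w := fun w => τ.commutes w
  refine ⟨τ, fun m => ?_, ?_, fun w => ?_⟩
  · rw [← hσM, ← hτ]
    rfl
  · rw [← hσb, ← hτ]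
    rfl
  · obtain ⟨p, rfl⟩ := pb.exists_eq_aeval' w
    have h1 : τ (aeval pb.gen p) = p.eval₂ σ ζ := pb.lift_aeval ζ hζ0' p
    have h2 : j (aeval pb.gen p) = p.eval₂ i (j pb.gen) := by rw [aeval_def, hom_eval₂]
    rw [h2]
    simp only [RingHom.coe_coe]
    rw [h1]
    exact Near.eval₂ hσ hζ p

end LaurentSeries

/-! ### Existential formulas under perturbation -/

namespace ThreeSorted

open LaurentSeries

variable {k : Type*} [Field k] {L : Type*} [Field L]

/-- The sequence `σ` of assignments represents the image of `ρ` under the perturbation `τ` of the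
embedding `j`. -/
structure IsPerturbation (j : L →+* LaurentSeries k) (τ : L →+* Ultra k)
    (ρ : Assignment (LaurentSeries k) k (WithTop ℤ))
    (σ : ℕ → Assignment (LaurentSeries k) k (WithTop ℤ)) : Prop where
  field (m : ℕ) : ∃ w : L, j w = ρ.field m ∧ τ w = ((fun n => (σ n).field m :
      ℕ → LaurentSeries k) : Ultra k)
  residue (n m : ℕ) : (σ n).residue m = ρ.residue m
  value (n m : ℕ) : (σ n).value m = ρ.value m

variable {j : L →+* LaurentSeries k} {τ : L →+* Ultra k}
  {ρ : Assignment (LaurentSeries k) k (WithTop ℤ)}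
  {σ : ℕ → Assignment (LaurentSeries k) k (WithTop ℤ)}

theorem FieldTerm.exists_eval (hC : ∀ c : k, ∃ w : L, j w = HahnSeries.C c ∧
      τ w = diag k (HahnSeries.C c)) (h : IsPerturbation j τ ρ σ) (a : FieldTerm k) :
    ∃ w : L, j w = a.eval (laurent k) ρ ∧
      τ w = ((fun n => a.eval (laurent k) (σ n) : ℕ → LaurentSeries k) : Ultra k) := by
  induction a with
  | var n => exact h.field n
  | const c => exact hC c
  | zero => exact ⟨0, map_zero j, map_zero τ⟩
  | one => exact ⟨1, map_one j, map_one τ⟩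
  | neg a iha =>
    obtain ⟨w, hw, hw'⟩ := iha
    exact ⟨-w, by rw [map_neg, hw]; rfl, by rw [map_neg, hw']; rfl⟩
  | add a b iha ihb =>
    obtain ⟨w, hw, hw'⟩ := iha
    obtain ⟨v, hv, hv'⟩ := ihb
    exact ⟨w + v, by rw [map_add, hw, hv]; rfl, by rw [map_add, hw', hv']; rfl⟩
  | mul a b iha ihb =>
    obtain ⟨w, hw, hw'⟩ := iha
    obtain ⟨v, hv, hv'⟩ := ihb
    exact ⟨w * v, by rw [map_mul, hw, hv]; rfl, by rw [map_mul, hw', hv']; rfl⟩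

/-- The valuation is discontinuous only at 0, and there τ 0 = 0 exactly. -/
theorem laurent_eventually_val_eq (hτ : ∀ w, Near (τ w) (j w)) {w : L} {u : ℕ → LaurentSeries k}
    (hu : τ w = (u : Ultra k)) :
    ∀ᶠ n in hyperfilter ℕ, (laurent k).val (u n) = (laurent k).val (j w) := by
  by_cases hw : w = 0
  · subst hw
    rw [map_zero] at hu
    have : ∀ᶠ n in (hyperfilter ℕ : Filter ℕ), 0 = u n := Germ.coe_eq.1 hu
    filter_upwards [this] with n hn
    rw [← hn, map_zero]
  · have h1 := hτ w
    rw [hu, near_coe] at h1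
    exact eventually_orderTop_eq h1 ((map_ne_zero j).2 hw)

theorem laurent_eventually_res_eq (hτ : ∀ w, Near (τ w) (j w)) {w : L} {u : ℕ → LaurentSeries k}
    (hu : τ w = (u : Ultra k)) :
    ∀ᶠ n in hyperfilter ℕ, (laurent k).res (u n) = (laurent k).res (j w) := by
  have h1 := hτ w
  rw [hu, near_coe] at h1
  filter_upwards [eventually_orderTop_nonneg_iff h1, tendsto_iff_coeff.1 h1 1] with n h2 h3
  simp only [laurent, HahnSeries.addVal_apply, h2, h3 0 (by norm_num)]

theorem ResidueTerm.eventually_eval_eq (hC : ∀ c : k, ∃ w : L, j w = HahnSeries.C c ∧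
      τ w = diag k (HahnSeries.C c)) (hτ : ∀ w, Near (τ w) (j w)) (h : IsPerturbation j τ ρ σ)
    (a : ResidueTerm k) :
    ∀ᶠ n in hyperfilter ℕ, a.eval (laurent k) (σ n) = a.eval (laurent k) ρ := by
  induction a with
  | var m => exact Eventually.of_forall fun n => h.residue n m
  | zero => exact Eventually.of_forall fun n => rfl
  | one => exact Eventually.of_forall fun n => rfl
  | neg a iha => filter_upwards [iha] with n hn; simp only [ResidueTerm.eval, hn]
  | add a b iha ihb => filter_upwards [iha, ihb] with n hn hn'; simp only [ResidueTerm.eval, hn,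
      hn']
  | mul a b iha ihb => filter_upwards [iha, ihb] with n hn hn'; simp only [ResidueTerm.eval, hn,
      hn']
  | res a =>
    obtain ⟨w, hw, hw'⟩ := a.exists_eval hC h
    filter_upwards [laurent_eventually_res_eq hτ hw'] with n hn
    simp only [ResidueTerm.eval, ← hw, hn]

theorem ValueTerm.eventually_eval_eq (hC : ∀ c : k, ∃ w : L, j w = HahnSeries.C c ∧
      τ w = diag k (HahnSeries.C c)) (hτ : ∀ w, Near (τ w) (j w)) (h : IsPerturbation j τ ρ σ)
    (a : ValueTerm k) :
    ∀ᶠ n in hyperfilter ℕ, a.eval (laurent k) (σ n) = a.eval (laurent k) ρ := by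
  induction a with
  | var m => exact Eventually.of_forall fun n => h.value n m
  | zero => exact Eventually.of_forall fun n => rfl
  | infty => exact Eventually.of_forall fun n => rfl
  | add a b iha ihb => filter_upwards [iha, ihb] with n hn hn'; simp only [ValueTerm.eval, hn, hn']
  | val a =>
    obtain ⟨w, hw, hw'⟩ := a.exists_eval hC h
    filter_upwards [laurent_eventually_val_eq hτ hw'] with n hn
    simp only [ValueTerm.eval, ← hw, hn]

/-- Field equations are both preserved and reflected because j and τ are injective; residue and
value terms are eventually constant. -/
theorem Formula.IsQuantifierFree.eventually_realize_iff (hC : ∀ c : k, ∃ w : L,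
      j w = HahnSeries.C c ∧ τ w = diag k (HahnSeries.C c)) (hτ : ∀ w, Near (τ w) (j w))
    (h : IsPerturbation j τ ρ σ) {φ : Formula k} (hφ : φ.IsQuantifierFree) :
    ∀ᶠ n in hyperfilter ℕ, (φ.Realize (laurent k) (σ n) ↔ φ.Realize (laurent k) ρ) := by
  induction φ with
  | verum => exact Eventually.of_forall fun n => Iff.rfl
  | falsum => exact Eventually.of_forall fun n => Iff.rfl
  | eqField a b =>
    obtain ⟨w, hw, hw'⟩ := a.exists_eval hC h
    obtain ⟨v, hv, hv'⟩ := b.exists_eval hC h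
    simp only [Formula.Realize, ← hw, ← hv, j.injective.eq_iff]
    by_cases hwv : w = v
    · have h1 : ∀ᶠ n in (hyperfilter ℕ : Filter ℕ),
          a.eval (laurent k) (σ n) = b.eval (laurent k) (σ n) :=
        Germ.coe_eq.1 (by rw [← hw', ← hv', hwv])
      filter_upwards [h1] with n hn
      simp only [hn, hwv]
    · have h1 : ∀ᶠ n in (hyperfilter ℕ : Filter ℕ),
          ¬ a.eval (laurent k) (σ n) = b.eval (laurent k) (σ n) := by
        rw [Ultrafilter.eventually_not]
        intro h2
        exact hwv (τ.injective (by rw [hw', hv']; exact Germ.coe_eq.2 h2))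
      filter_upwards [h1] with n hn
      simp only [hn, hwv]
  | eqResidue a b =>
    filter_upwards [a.eventually_eval_eq hC hτ h, b.eventually_eval_eq hC hτ h] with n ha hb
    simp only [Formula.Realize, ha, hb]
  | eqValue a b =>
    filter_upwards [a.eventually_eval_eq hC hτ h, b.eventually_eval_eq hC hτ h] with n ha hb
    simp only [Formula.Realize, ha, hb]
  | ltValue a b =>
    filter_upwards [a.eventually_eval_eq hC hτ h, b.eventually_eval_eq hC hτ h] with n ha hb
    simp only [Formula.Realize, ha, hb]
  | not φ ih =>
    filter_upwards [ih hφ] with n hn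
    simp only [Formula.Realize, hn]
  | and φ ψ ihφ ihψ =>
    filter_upwards [ihφ hφ.1, ihψ hφ.2] with n hn hn'
    simp only [Formula.Realize, hn, hn']
  | or φ ψ ihφ ihψ =>
    filter_upwards [ihφ hφ.1, ihψ hφ.2] with n hn hn'
    simp only [Formula.Realize, hn, hn']
  | ex s n φ ih => exact hφ.elim
  | all s n φ ih => exact hφ.elim

/-- S collects the field-sort witnesses, which τ moves along with the variables; residue and value
witnesses stay put. S is chosen before L, so that L can be taken finitely generated and still
contain it. -/
theorem Formula.IsExistential.exists_finite_witnesses {φ : Formula k} (hφ : φ.IsExistential)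
    (ρ : Assignment (LaurentSeries k) k (WithTop ℤ)) (hρ : φ.Realize (laurent k) ρ) :
    ∃ S : Set (LaurentSeries k), S.Finite ∧ ∀ (L : Type*) [Field L] (j : L →+* LaurentSeries k)
      (τ : L →+* Ultra k) (σ : ℕ → Assignment (LaurentSeries k) k (WithTop ℤ)),
      (∀ c : k, ∃ w : L, j w = HahnSeries.C c ∧ τ w = diag k (HahnSeries.C c)) →
      (∀ w, Near (τ w) (j w)) → S ⊆ Set.range j → IsPerturbation j τ ρ σ →
      ∀ᶠ n in hyperfilter ℕ, φ.Realize (laurent k) (σ n) := by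
  induction hφ generalizing ρ with
  | quantifierFree h =>
    refine ⟨∅, Set.finite_empty, fun L _ j τ σ hC hτ _ hσ => ?_⟩
    filter_upwards [h.eventually_realize_iff hC hτ hσ] with n hn
    exact hn.2 hρ
  | and _ _ ihφ ihψ =>
    obtain ⟨S, hS, hS'⟩ := ihφ ρ hρ.1
    obtain ⟨T, hT, hT'⟩ := ihψ ρ hρ.2
    refine ⟨S ∪ T, hS.union hT, fun L _ j τ σ hC hτ hST hσ => ?_⟩
    filter_upwards [hS' L j τ σ hC hτ (Set.subset_union_left.trans hST) hσ,
      hT' L j τ σ hC hτ (Set.subset_union_right.trans hST) hσ] with n h1 h2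
    exact ⟨h1, h2⟩
  | or _ _ ihφ ihψ =>
    rcases hρ with hρ | hρ
    · obtain ⟨S, hS, hS'⟩ := ihφ ρ hρ
      exact ⟨S, hS, fun L _ j τ σ hC hτ hST hσ => (hS' L j τ σ hC hτ hST hσ).mono fun n => Or.inl⟩
    · obtain ⟨S, hS, hS'⟩ := ihψ ρ hρ
      exact ⟨S, hS, fun L _ j τ σ hC hτ hST hσ => (hS' L j τ σ hC hτ hST hσ).mono fun n => Or.inr⟩
  | ex s m _ ih =>
    cases s with
    | field =>
      obtain ⟨a, ha⟩ := hρ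
      obtain ⟨S, hS, hS'⟩ := ih _ ha
      refine ⟨insert a S, hS.insert a, fun L _ j τ σ hC hτ hST hσ => ?_⟩
      obtain ⟨w, hw⟩ := hST (Set.mem_insert a S)
      obtain ⟨u, hu⟩ : ∃ u : ℕ → LaurentSeries k, (u : Ultra k) = τ w :=
        Quotient.exists_rep (τ w)
      refine (hS' L j τ (fun n => (σ n).updateField m (u n)) hC hτ
        ((Set.subset_insert a S).trans hST) ⟨fun i => ?_, hσ.residue, hσ.value⟩).mono
        fun n hn => ⟨u n, hn⟩
      by_cases hi : i = m
      · subst hi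
        exact ⟨w, by simp [Assignment.updateField, hw], by simp [Assignment.updateField, hu]⟩
      · simpa [Assignment.updateField, Function.update_of_ne hi] using hσ.field i
    | residue =>
      obtain ⟨a, ha⟩ := hρ
      obtain ⟨S, hS, hS'⟩ := ih _ ha
      refine ⟨S, hS, fun L _ j τ σ hC hτ hST hσ => (hS' L j τ (fun n => (σ n).updateResidue m a)
        hC hτ hST ⟨hσ.field, fun n i => ?_, hσ.value⟩).mono fun n hn => ⟨a, hn⟩⟩
      simp only [Assignment.updateResidue, Function.update_apply, hσ.residue]
    | value =>
      obtain ⟨a, ha⟩ := hρ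
      obtain ⟨S, hS, hS'⟩ := ih _ ha
      refine ⟨S, hS, fun L _ j τ σ hC hτ hST hσ => (hS' L j τ (fun n => (σ n).updateValue m a)
        hC hτ hST ⟨hσ.field, hσ.residue, fun n i => ?_⟩).mono fun n hn => ⟨a, hn⟩⟩
      simp only [Assignment.updateValue, Function.update_apply, hσ.value]

end ThreeSorted

/-! ### Separable generation over k(x) and algebraic exchange -/

section Separability

open IntermediateField

variable {k K : Type*} [Field k] [Field K] [Algebra k K] {p : ℕ} [Fact p.Prime]

/-- If `x` is not a `p`-th power in `K`, its powers `x ^ j` with `j < p` are linearly independent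
over `K ^ p`. -/
theorem eq_zero_of_sum_pow_mul_pow_eq_zero [CharP K p] {x : K} (hx : ∀ b : K, b ^ p ≠ x)
    (y : ℕ → K) (h : ∑ i ∈ Finset.range p, x ^ i * y i ^ p = 0) : ∀ i < p, y i = 0 := by
  have hp : p.Prime := Fact.out
  set F := (frobenius K p).fieldRange with hF
  have hmem : ∀ a : K, a ^ p ∈ F := fun a => ⟨a, rfl⟩
  -- A p-th root of x^p inside K^p has the form b^p, and injectivity of Frobenius would give b^p =
  -- x.
  have hirr : Irreducible (X ^ p - C (⟨x ^ p, hmem x⟩ : F)) := by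
    refine X_pow_sub_C_irreducible_of_prime hp ?_
    rintro ⟨_, b, rfl⟩ hb
    have h1 : (frobenius K p b) ^ p = x ^ p := congrArg Subtype.val hb
    exact hx b (frobenius_inj K p h1)
  have hmin : X ^ p - C (⟨x ^ p, hmem x⟩ : F) = minpoly F x :=
    minpoly.eq_of_irreducible_of_monic hirr (by
      simp only [aeval_def, eval₂_sub, eval₂_pow, eval₂_X, eval₂_C]
      exact sub_self _) (monic_X_pow_sub_C _ hp.ne_zero)
  set q : F[X] := ∑ i ∈ Finset.range p, C (⟨y i ^ p, hmem (y i)⟩ : F) * X ^ i with hq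
  have hq0 : q = 0 := by
    by_contra hne
    have h1 := minpoly.degree_le_of_ne_zero F x hne (by
      rw [hq, map_sum, ← h]
      refine Finset.sum_congr rfl fun i _ => ?_
      rw [map_mul, map_pow, aeval_X, aeval_C, mul_comm]
      rfl)
    rw [← hmin, degree_X_pow_sub_C hp.pos] at h1
    refine absurd h1 (not_le.2 ?_)
    refine (degree_sum_le _ _).trans_lt ?_
    rw [Finset.sup_lt_iff (by exact_mod_cast WithBot.bot_lt_coe _)]
    intro i hi
    refine (degree_C_mul_X_pow_le _ _).trans_lt ?_
    exact_mod_cast Finset.mem_range.1 hi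
  intro i hi
  have h1 : q.coeff i = ⟨y i ^ p, hmem (y i)⟩ := by
    simp [hq, finsetSum_coeff, coeff_C_mul, coeff_X_pow, hi]
  rw [hq0, coeff_zero] at h1
  exact pow_eq_zero_iff hp.ne_zero |>.1 (congrArg Subtype.val h1).symm

/-- Perfectness of k makes constants p-th powers, so 1, x, …, x^(p-1) span k(x) over its p-th
powers. -/
theorem exists_eq_sum_pow_mul_pow_of_mem_adjoin_simple [PerfectField k] [CharP k p] [CharP K p]
    {x : K} (c : k⟮x⟯) : ∃ d : ℕ → k⟮x⟯,
      c = ∑ i ∈ Finset.range p, AdjoinSimple.gen k x ^ i * d i ^ p := by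
  have hp : p.Prime := Fact.out
  have : CharP k⟮x⟯ p := charP_of_injective_algebraMap (algebraMap k k⟮x⟯).injective p
  have : ExpChar k p := ExpChar.prime hp
  have : PerfectRing k p := PerfectField.toPerfectRing p
  set g := AdjoinSimple.gen k x
  have hpoly : ∀ f : k[X], ∃ d : ℕ → k⟮x⟯,
      aeval g f = ∑ i ∈ Finset.range p, g ^ i * d i ^ p := by
    intro f
    induction f using Polynomial.induction_on with
    | C a =>
      obtain ⟨b, hb⟩ := surjective_frobenius k p a
      refine ⟨fun i => if i = 0 then algebraMap k _ b else 0, ?_⟩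
      rw [Finset.sum_eq_single 0]
      · rw [aeval_C, ← hb]
        simp [frobenius_def]
      · intro i _ hi
        simp [hi, hp.ne_zero]
      · intro h0
        exact absurd (Finset.mem_range.2 hp.pos) h0
    | add f h hf hh =>
      obtain ⟨d, hd⟩ := hf
      obtain ⟨e, he⟩ := hh
      refine ⟨d + e, ?_⟩
      rw [map_add, hd, he, ← Finset.sum_add_distrib]
      refine Finset.sum_congr rfl fun i _ => ?_
      rw [Pi.add_apply, add_pow_char, mul_add]
    | monomial n a ih =>
      obtain ⟨d, hd⟩ := ih
      obtain ⟨q, rfl⟩ : ∃ q, p = q + 1 := ⟨p - 1, (Nat.succ_pred_prime hp).symm⟩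
      -- Multiplication by g shifts the coefficients; the top term becomes g^p d_{p-1}^p, a p-th
      -- power, and wraps round to index 0.
      refine ⟨fun i => if i = 0 then g * d q else d (i - 1), ?_⟩
      rw [pow_succ, ← mul_assoc, map_mul, hd, aeval_X, Finset.sum_range_succ, add_mul,
        Finset.sum_range_succ', Finset.sum_mul]
      congr 1
      · refine Finset.sum_congr rfl fun i _ => ?_
        simp only [Nat.add_eq_zero_iff, one_ne_zero, and_false, if_false, Nat.add_sub_cancel]
        ring
      · simp only [if_true]
        ring
  obtain ⟨r, s, hrs⟩ := (mem_adjoin_simple_iff k (c : K)).1 c.2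
  have hc : c = aeval g r / aeval g s := by
    apply Subtype.ext
    rw [hrs, IntermediateField.coe_div, ← aeval_coe, ← aeval_coe]
    simp [g]
  -- Writing r/s = r s^(p-1) / s^p turns the denominator into a p-th power.
  obtain ⟨d, hd⟩ := hpoly (r * s ^ (p - 1))
  by_cases hs : aeval g s = 0
  · refine ⟨0, ?_⟩
    rw [hc, hs, div_zero]
    simp [hp.ne_zero]
  · refine ⟨fun i => d i / aeval g s, ?_⟩
    have h1 : c = aeval g (r * s ^ (p - 1)) / aeval g s ^ p := by
      rw [hc, map_mul, map_pow, ← Nat.succ_pred_prime hp]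
      simp only [Nat.pred_eq_sub_one, Nat.succ_eq_add_one, Nat.add_sub_cancel]
      field_simp
      ring
    rw [h1, hd, Finset.sum_div]
    refine Finset.sum_congr rfl fun i _ => ?_
    rw [div_pow, mul_div_assoc]

/-- This is the hypothesis of MacLane's criterion. Expanding each coefficient in powers of x with
p-th power coefficients turns a relation among p-th powers into ∑ x^j yⱼ^p = 0, where each yⱼ is a
linear combination of the original elements. -/
theorem linearIndepOn_pow_of_forall_pow_ne [PerfectField k] [CharP k p] [CharP K p] {x : K}
    (hx : ∀ b : K, b ^ p ≠ x) {L : IntermediateField k⟮x⟯ K} (s : Finset L)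
    (hs : LinearIndepOn k⟮x⟯ id (s : Set L)) : LinearIndepOn k⟮x⟯ (· ^ p) (s : Set L) := by
  have hp : p.Prime := Fact.out
  have : CharP L p := charP_of_injective_algebraMap
    (algebraMap L K).injective.of_comp p
  rw [linearIndepOn_finset_iff] at hs ⊢
  intro c hc i hi
  choose d hd using fun i => exists_eq_sum_pow_mul_pow_of_mem_adjoin_simple (p := p) (c i)
  have h1 : ∑ j ∈ Finset.range p, x ^ j * ((∑ i ∈ s, d i j • i : L) : K) ^ p = 0 := by
    have h2 := congrArg (algebraMap L K) hc
    rw [map_zero, map_sum] at h2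
    rw [← h2]
    have h3 : ∀ j, ((∑ i ∈ s, d i j • i : L) : K) ^ p = ∑ i ∈ s, (d i j : K) ^ p * (i : K) ^ p := by
      intro j
      rw [← frobenius_def, ← IntermediateField.algebraMap_apply, map_sum, map_sum]
      refine Finset.sum_congr rfl fun i _ => ?_
      rw [frobenius_def, ← mul_pow]
      rfl
    simp only [h3, Finset.mul_sum]
    rw [Finset.sum_comm]
    refine Finset.sum_congr rfl fun i _ => ?_
    have h4 : (c i : K) = ∑ j ∈ Finset.range p, x ^ j * (d i j : K) ^ p := by
      conv_lhs => rw [hd i]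
      simp
    have h5 : (algebraMap L K) (c i • i ^ p) = (c i : K) * (i : K) ^ p := rfl
    rw [h5, h4, Finset.sum_mul]
    exact Finset.sum_congr rfl fun j _ => (mul_assoc _ _ _).symm
  have h6 := eq_zero_of_sum_pow_mul_pow_eq_zero hx _ h1
  rw [hd i]
  refine Finset.sum_eq_zero fun j hj => ?_
  have h7 := hs (fun i => d i j) (Subtype.ext (h6 j (Finset.mem_range.1 hj))) i hi
  rw [show d i j = 0 from h7, zero_pow hp.ne_zero, mul_zero]

omit [Fact p.Prime] in
/-- If `x ∈ K` is not a `p`-th power (in characteristic `p`), then every finitely generated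
extension of `k(x)` in `K` is separably generated. -/
theorem exists_isTranscendenceBasis_isSeparable_over_adjoin_simple [PerfectField k] {x : K}
    (hx : ∀ p : ℕ, p.Prime → CharP k p → ∀ b : K, b ^ p ≠ x)
    (L : IntermediateField k⟮x⟯ K) [Algebra.EssFiniteType k⟮x⟯ L] :
    ∃ s : Finset L, IsTranscendenceBasis k⟮x⟯ ((↑) : s → L) ∧
      Algebra.IsSeparable (IntermediateField.adjoin k⟮x⟯ (s : Set L)) L := by
  obtain h0 | ⟨p, hp, hpk⟩ := CharP.exists' k
  · have : CharZero k⟮x⟯ := charZero_of_injective_algebraMap (algebraMap k k⟮x⟯).injective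
    exact exists_isTranscendenceBasis_and_isSeparable_of_perfectField _ _
  · have : CharP K p := charP_of_injective_algebraMap (algebraMap k K).injective p
    exact exists_isTranscendenceBasis_and_isSeparable_of_linearIndepOn_pow_of_essFiniteType p
      hp.out (fun s => linearIndepOn_pow_of_forall_pow_ne (hx p hp.out hpk) s)

/-- If `y` is transcendental over `E` and algebraic over `E(s)` with `s` finite, then some
`b ∈ s` is algebraic over the extension of `E` generated by `y` and the other elements of `s`. -/
theorem exists_isAlgebraic_adjoin_insert {E L : Type*} [Field E] [Field L] [Algebra E L]
    (s : Finset L) {y : L} (hy : Transcendental E y)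
    (hys : IsAlgebraic (Algebra.adjoin E (s : Set L)) y) :
    ∃ b ∈ s, IsAlgebraic (Algebra.adjoin E (insert y ((s : Set L) \ {b}))) b := by
  classical
  set N := AlgebraicIndependent.matroid E L
  have hmem : ∀ (T : Set L) (a : L), a ∈ N.closure T ↔ IsAlgebraic (Algebra.adjoin E T) a :=
    fun T a => by rw [AlgebraicIndependent.matroid_closure_eq]; rfl
  have h0 : y ∉ N.closure ∅ := by
    rw [hmem, Algebra.adjoin_empty]
    have : Algebra.IsIntegral E (⊥ : Subalgebra E L) :=
      Algebra.isIntegral_of_surjective (Algebra.botEquiv E L).symm.surjective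
    exact fun h => hy (h.restrictScalars E)
  have key : ∀ s : Finset L, y ∈ N.closure (s : Set L) →
      ∃ b ∈ s, b ∈ N.closure (insert y ((s : Set L) \ {b})) := by
    intro s
    induction s using Finset.induction_on with
    | empty => intro h; simp only [Finset.coe_empty] at h; exact (h0 h).elim
    | insert b s hb ih =>
      intro h
      -- Either b is superfluous for y, or matroid exchange swaps b with y.
      by_cases h1 : y ∈ N.closure (s : Set L)
      · obtain ⟨c, hc, hc'⟩ := ih h1
        refine ⟨c, Finset.mem_insert_of_mem hc, N.closure_subset_closure ?_ hc'⟩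
        refine Set.insert_subset_insert (Set.sdiff_subset_sdiff_left ?_)
        simp
      · refine ⟨b, Finset.mem_insert_self _ _, N.closure_subset_closure ?_
          (Matroid.mem_closure_insert h1 (by simpa using h))⟩
        refine Set.insert_subset_insert fun x hx => ⟨by simp [hx], ?_⟩
        rintro rfl
        exact hb hx
  obtain ⟨b, hb, hb'⟩ := key s ((hmem _ _).2 hys)
  exact ⟨b, hb, (hmem _ _).1 hb'⟩

/-- An extension containing `t`, `y` algebraically independent is not algebraic over `k(x)`. -/
theorem transcendental_or_transcendental_over_adjoin_simple {t y : K} (ht : Transcendental k t)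
    (hy : Transcendental (Algebra.adjoin k {t}) y) (x : K) :
    Transcendental k⟮x⟯ t ∨ Transcendental k⟮x⟯ y := by
  by_contra! h
  set N := AlgebraicIndependent.matroid k K
  have hmem : ∀ z : K, ¬ Transcendental k⟮x⟯ z → z ∈ N.closure {x} := by
    intro z hz
    rw [AlgebraicIndependent.matroid_closure_eq]
    exact isAlgebraic_adjoin_iff.1 (not_not.1 hz)
  have hind : N.Indep {y, t} := by
    rw [AlgebraicIndependent.matroid_indep_iff]
    refine AlgebraicIndepOn.insert ?_ (by rwa [Set.image_id])
    exact (algebraicIndependent_unique_type_iff).2 ht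
  have hne : y ≠ t := by
    rintro rfl
    exact hy (isAlgebraic_algebraMap
      (⟨y, Algebra.self_mem_adjoin_singleton k y⟩ : Algebra.adjoin k {y}))
  -- An independent pair would lie in the closure of a single point, which has rank at most 1.
  have h1 := N.eRk_mono
    (Set.insert_subset (hmem y h.2) (Set.singleton_subset_iff.2 (hmem t h.1)))
  rw [hind.eRk_eq_encard, Matroid.eRk_closure_eq, Set.encard_pair hne] at h1
  have h2 := h1.trans (N.eRk_le_encard {x})
  rw [Set.encard_singleton] at h2
  exact absurd h2 (by decide)

end Separability

/-! ### Transcendence of a lacunary power series -/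

section Liouville

open scoped Nat
open scoped Classical in
/-- The power series `∑ X ^ (n !)`. -/
noncomputable def PowerSeries.liouville (k : Type*) [Field k] : PowerSeries k :=
  PowerSeries.mk fun m => if ∃ n, m = n ! then 1 else 0

variable {k : Type*} [Field k]

theorem PowerSeries.X_pow_dvd_liouville_sub_trunc (N : ℕ) :
    (PowerSeries.X : PowerSeries k) ^ (N + 1)! ∣
      liouville k - (trunc (N ! + 1) (liouville k) : Polynomial k) := by
  rw [PowerSeries.X_pow_dvd_iff]
  intro m hm
  rw [map_sub, Polynomial.coeff_coe, coeff_trunc]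
  split_ifs with h
  · exact sub_self _
  · rw [sub_zero, liouville, coeff_mk, if_neg]
    rintro ⟨n, rfl⟩
    rcases le_or_gt n N with hn | hn
    · exact h (Nat.lt_succ_of_le (Nat.factorial_le hn))
    · exact absurd (Nat.factorial_le hn) (not_le.2 hm)

/-- The coefficient at the larger factorial separates two truncations. The index starts at 1 because
0! = 1!. -/
theorem PowerSeries.trunc_liouville_injective :
    Function.Injective fun N : ℕ => trunc ((N + 1)! + 1) (liouville k) := by
  have key : ∀ N M : ℕ, N < M → trunc ((N + 1)! + 1) (liouville k) ≠
      trunc ((M + 1)! + 1) (liouville k) := by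
    intro N M hNM h
    have h1 := congrArg (fun q => q.coeff (M + 1)!) h
    simp only [coeff_trunc] at h1
    rw [if_neg, if_pos (Nat.lt_succ_self _), liouville, coeff_mk, if_pos ⟨_, rfl⟩] at h1
    · exact zero_ne_one h1
    · have := (Nat.factorial_lt (Nat.succ_pos N)).2 (Nat.succ_lt_succ hNM)
      exact not_lt.2 this
  intro N M h
  by_contra hne
  rcases lt_or_gt_of_ne hne with h1 | h1
  · exact key _ _ h1 h
  · exact key _ _ h1 h.symm

/-- `∑ X ^ (n !)` is transcendental over `k[X]`. -/
theorem PowerSeries.eval₂_liouville_ne_zero {Q : k[X][X]} (hQ : Q ≠ 0) :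
    Q.eval₂ (Polynomial.coeToPowerSeries.ringHom (R := k)) (liouville k) ≠ 0 := by
  intro h0
  set D := Q.support.sup fun i => (Q.coeff i).natDegree
  set d := Q.natDegree
  -- Liouville's argument: Q evaluated at the truncation has degree at most D + d·N! < (N+1)!, yet
  -- is divisible by X^((N+1)!), so it vanishes. Infinitely many distinct truncations are then roots
  -- of Q.
  have hroot : ∀ N, D + d ≤ N → Q.eval (trunc (N ! + 1) (liouville k)) = 0 := by
    intro N hN
    set T := trunc (N ! + 1) (liouville k) with hT
    have hTdeg : T.natDegree ≤ N ! := Nat.le_of_lt_succ (natDegree_trunc_lt _ _)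
    have hdeg : (Q.eval T).natDegree < (N + 1)! := by
      have h1 : (Q.eval T).natDegree ≤ D + d * N ! := by
        rw [eval_eq_sum, Polynomial.sum]
        refine natDegree_sum_le_of_forall_le _ _ fun i hi => ?_
        refine natDegree_mul_le.trans (Nat.add_le_add (Finset.le_sup (f := fun i =>
          (Q.coeff i).natDegree) hi) ?_)
        exact natDegree_pow_le.trans (Nat.mul_le_mul (le_natDegree_of_mem_supp _ hi) hTdeg)
      have h2 : 0 < N ! := Nat.factorial_pos N
      have h3 : D + d * N ! ≤ (D + d) * N ! := by nlinarith
      have h4 : (D + d) * N ! ≤ N * N ! := Nat.mul_le_mul_right _ hN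
      rw [Nat.factorial_succ]
      linarith
    have hdvd : (X : PowerSeries k) ^ (N + 1)! ∣ ((Q.eval T : k[X]) : PowerSeries k) := by
      have h1 := sub_dvd_eval_sub (liouville k) (T : PowerSeries k)
        (Q.map (Polynomial.coeToPowerSeries.ringHom (R := k)))
      rw [eval_map, eval_map, h0, zero_sub, dvd_neg] at h1
      have h2 : Q.eval₂ (Polynomial.coeToPowerSeries.ringHom (R := k)) (T : PowerSeries k) =
          ((Q.eval T : k[X]) : PowerSeries k) := by
        rw [← Polynomial.coeToPowerSeries.ringHom_apply, eval₂_at_apply]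
        rfl
      rw [h2] at h1
      exact (X_pow_dvd_liouville_sub_trunc N).trans h1
    ext m
    rcases lt_or_ge m (N + 1)! with hm | hm
    · rw [← Polynomial.coeff_coe, X_pow_dvd_iff.1 hdvd m hm, Polynomial.coeff_zero]
    · rw [coeff_eq_zero_of_natDegree_lt (hdeg.trans_le hm), Polynomial.coeff_zero]
  refine hQ (eq_zero_of_infinite_isRoot Q ?_)
  refine (Set.infinite_range_of_injective ((trunc_liouville_injective (k := k)).comp
    (add_left_injective (D + d)))).mono ?_
  rintro _ ⟨n, rfl⟩
  exact hroot _ (by dsimp only; omega)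

end Liouville

/-! ### Two independent series, and generators that are not p-th powers -/

namespace LaurentSeries

open IntermediateField

variable {k : Type*} [Field k]

theorem algebraMap_eq_C (a : k) : algebraMap k (LaurentSeries k) a = HahnSeries.C a :=
  LaurentSeries.algebraMap_apply k a

theorem aeval_X_eq_coe (f : k[X]) :
    aeval ((PowerSeries.X : PowerSeries k) : LaurentSeries k) f =
      ((f : PowerSeries k) : LaurentSeries k) := by
  have hc : ∀ a : k, HahnSeries.ofPowerSeries ℤ k (PowerSeries.C a) = HahnSeries.C a := fun a =>
    PowerSeries.coe_C a
  induction f using Polynomial.induction_on' with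
  | add f g hf hg => rw [map_add, hf, hg, Polynomial.coe_add, map_add]
  | monomial n a =>
    rw [aeval_monomial, algebraMap_eq_C, ← hc, ← map_pow, ← map_mul, ← C_mul_X_pow_eq_monomial,
      Polynomial.coe_mul, Polynomial.coe_pow, Polynomial.coe_C, Polynomial.coe_X]

theorem transcendental_liouville :
    Transcendental (Algebra.adjoin k {((PowerSeries.X : PowerSeries k) : LaurentSeries k)})
      (PowerSeries.liouville k : LaurentSeries k) := by
  set t := ((PowerSeries.X : PowerSeries k) : LaurentSeries k)
  set A := Algebra.adjoin k {t}
  rw [transcendental_iff]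
  intro q hq
  set φ : k[X] →+* A :=
    (aeval (⟨t, Algebra.self_mem_adjoin_singleton k t⟩ : A) : k[X] →ₐ[k] A).toRingHom
  have hφt : ∀ f, algebraMap A (LaurentSeries k) (φ f) = aeval t f := fun f =>
    (aeval_algHom_apply A.val (⟨t, Algebra.self_mem_adjoin_singleton k t⟩ : A) f).symm
  have hφ : Function.Surjective φ := by
    rintro ⟨a, ha⟩
    obtain ⟨f, rfl⟩ : a ∈ (aeval t : k[X] →ₐ[k] LaurentSeries k).range := by
      rw [← Algebra.adjoin_singleton_eq_range_aeval]
      exact ha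
    refine ⟨f, Subtype.ext ?_⟩
    exact hφt f
  obtain ⟨Q, rfl⟩ := Polynomial.map_surjective φ hφ q
  by_contra hne
  have hQ : Q ≠ 0 := fun h => hne (by rw [h, Polynomial.map_zero])
  refine PowerSeries.eval₂_liouville_ne_zero hQ
    (HahnSeries.ofPowerSeries_injective (Γ := ℤ) (R := k) ?_)
  rw [map_zero, ← hq, hom_eval₂, aeval_def, eval₂_map]
  congr 1
  refine RingHom.ext fun f => ?_
  rw [RingHom.comp_apply, RingHom.comp_apply, hφt, aeval_X_eq_coe]
  rfl

theorem transcendental_X :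
    Transcendental k ((PowerSeries.X : PowerSeries k) : LaurentSeries k) := by
  rw [transcendental_iff]
  intro f hf
  rw [aeval_X_eq_coe] at hf
  exact Polynomial.coe_injective k (HahnSeries.ofPowerSeries_injective (Γ := ℤ) (by simpa using hf))

theorem exists_transcendental_over_adjoin_simple (x : LaurentSeries k) :
    Transcendental k⟮x⟯ ((PowerSeries.X : PowerSeries k) : LaurentSeries k) ∨
      Transcendental k⟮x⟯ (PowerSeries.liouville k : LaurentSeries k) :=
  transcendental_or_transcendental_over_adjoin_simple transcendental_X transcendental_liouville x

/-- Every element of `k((t))` lies in `k(x)` for some `x` which is not a `p`-th power. -/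
theorem exists_mem_adjoin_simple_forall_pow_ne [PerfectField k] (z : LaurentSeries k) :
    ∃ x : LaurentSeries k, z ∈ k⟮x⟯ ∧
      ∀ p : ℕ, p.Prime → CharP k p → ∀ b : LaurentSeries k, b ^ p ≠ x := by
  -- Extracting a p-th root divides the nonzero order by p, so the descent terminates.
  have key : ∀ n : ℕ, ∀ y : LaurentSeries k, y.order.natAbs = n → y.order ≠ 0 →
      ∃ x : LaurentSeries k, y ∈ k⟮x⟯ ∧
      ∀ p : ℕ, p.Prime → CharP k p → ∀ b : LaurentSeries k, b ^ p ≠ x := by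
    intro n
    induction n using Nat.strong_induction_on with | _ n ih
    intro y hyn hy
    by_cases h : ∀ p : ℕ, p.Prime → CharP k p → ∀ b : LaurentSeries k, b ^ p ≠ y
    · exact ⟨y, mem_adjoin_simple_self k y, h⟩
    · push Not at h
      obtain ⟨p, hp, _, b, rfl⟩ := h
      rw [HahnSeries.order_pow, nsmul_eq_mul] at hy hyn
      rw [Int.natAbs_mul, Int.natAbs_natCast] at hyn
      have hb : b.order ≠ 0 := fun h => hy (by rw [h, mul_zero])
      obtain ⟨x, hx, hx'⟩ := ih b.order.natAbs (by
        have h1 := hp.two_le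
        have h2 : 0 < b.order.natAbs := Int.natAbs_pos.2 hb
        nlinarith) b rfl hb
      exact ⟨x, pow_mem hx p, hx'⟩
  -- Removing the constant coefficient leaves 0 or a series of nonzero order, without affecting
  -- membership in k(x).
  set y := z - algebraMap k _ (z.coeff 0) with hy
  have hzy : z = y + algebraMap k _ (z.coeff 0) := by rw [hy, sub_add_cancel]
  have hlift : ∀ x : LaurentSeries k, y ∈ k⟮x⟯ → z ∈ k⟮x⟯ := fun x hx => by
    rw [hzy]
    exact add_mem hx (IntermediateField.algebraMap_mem _ _)
  by_cases hy0 : y = 0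
  · obtain ⟨x, hx, hx'⟩ := key _ (HahnSeries.single 1 1) rfl (by
      rw [HahnSeries.order_single one_ne_zero]; exact one_ne_zero)
    exact ⟨x, hlift x (hy0 ▸ zero_mem _), hx'⟩
  · obtain ⟨x, hx, hx'⟩ := key _ y rfl (fun h => by
      have h1 : y.coeff 0 = 0 := by
        rw [hy, algebraMap_eq_C, HahnSeries.coeff_sub]
        simp
      rw [← h] at h1
      exact hy0 (HahnSeries.coeff_order_eq_zero.1 h1))
    exact ⟨x, hlift x hx, hx'⟩

end LaurentSeries

/-! ### Perturbations that move a given element -/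

namespace LaurentSeries

open IntermediateField

variable {k : Type*} [Field k]

theorem eval₂_diag_coe {A : Type*} [CommRing A] (i : A →+* LaurentSeries k)
    (u : ℕ → LaurentSeries k)
    (p : A[X]) : p.eval₂ ((diag k).comp i) (u : Ultra k) =
      ((fun n => p.eval₂ i (u n) : ℕ → LaurentSeries k) : Ultra k) := by
  induction p using Polynomial.induction_on with
  | C a => simp [diag_apply]
  | add p q hp hq =>
    simp only [eval₂_add, hp, hq]
    rfl
  | monomial n a ih =>
    simp only [pow_succ, ← mul_assoc, eval₂_mul_X, ih]
    rfl

/-- An infinitesimal perturbation `τ b = b + X ^ n` cannot fix a field over which `b` is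
algebraic. -/
theorem not_isAlgebraic_of_fixed {A L : Type*} [CommRing A] [Field L] [Algebra A L]
    (hA : Function.Injective (algebraMap A L)) (j : L →+* LaurentSeries k)
    (τ : L →+* Ultra k) {b : L}
    (hfix : ∀ a : A, τ (algebraMap A L a) = diag k (j (algebraMap A L a)))
    (hb : τ b = ((fun n : ℕ => j b + HahnSeries.single (n : ℤ) 1 : ℕ → LaurentSeries k) :
        Ultra k)) :
    ¬ IsAlgebraic A b := by
  rintro ⟨p, hp, hpb⟩
  set i : A →+* LaurentSeries k := j.comp (algebraMap A L)
  have h1 : p.eval₂ ((diag k).comp i) (τ b) = 0 := by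
    rw [← map_zero τ, ← hpb, aeval_def, hom_eval₂]
    congr 1
    ext a
    exact (hfix a).symm
  rw [hb, eval₂_diag_coe] at h1
  have h2 : ∀ᶠ n : ℕ in hyperfilter ℕ,
      p.eval₂ i (j b + HahnSeries.single (n : ℤ) 1 : LaurentSeries k) = 0 := Germ.coe_eq.1 h1
  have h3 : {n : ℕ | p.eval₂ i (j b + HahnSeries.single (n : ℤ) 1 :
      LaurentSeries k) = 0}.Infinite :=
    fun hfin => notMem_hyperfilter_of_finite hfin h2
  have hinj : Function.Injective fun n : ℕ => (j b + HahnSeries.single (n : ℤ) 1 :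
      LaurentSeries k) := by
    intro n m hnm
    have h4 := congrArg (fun z : LaurentSeries k => z.coeff n) (add_left_cancel hnm)
    simp only [HahnSeries.coeff_single_same] at h4
    by_contra hne
    rw [HahnSeries.coeff_single_of_ne (by exact_mod_cast hne)] at h4
    exact one_ne_zero h4
  -- The elements b + t^n are distinct, and infinitely many of them are roots.
  have h5 : p.map i = 0 := by
    refine eq_zero_of_infinite_isRoot _ ((h3.image hinj.injOn).mono ?_)
    rintro _ ⟨n, hn, rfl⟩
    rw [Set.mem_ofPred_eq, IsRoot, eval_map]
    exact hn
  exact hp ((Polynomial.map_eq_zero_iff (show Function.Injective i from j.injective.comp hA)).1 h5)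

end LaurentSeries

section Perturbation

open LaurentSeries IntermediateField

variable {k : Type*} [Field k] {E L : Type*} [Field E] [Field L] [Algebra E L]

/-- Every element transcendental over `E` of a separably generated extension is moved by some
infinitesimal perturbation over `E`. -/
theorem exists_near_hom_moving [Algebra.EssFiniteType E L] (j : L →+* LaurentSeries k)
    (s : Finset L)
    (hs : IsTranscendenceBasis E ((↑) : s → L))
    [Algebra.IsSeparable (IntermediateField.adjoin E (s : Set L)) L]
    {w : L} (hw : Transcendental E w) :
    ∃ τ : L →+* Ultra k, (∀ a : E, τ (algebraMap E L a) = diag k (j (algebraMap E L a))) ∧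
      (∀ z, Near (τ z) (j z)) ∧ τ w ≠ diag k (j w) := by
  have hrange : Set.range ((↑) : s → L) = (s : Set L) := Subtype.range_coe
  obtain ⟨b, hbs, hb⟩ := exists_isAlgebraic_adjoin_insert s hw (by
    have := hs.isAlgebraic
    rw [hrange] at this
    exact this.isAlgebraic w)
  set M := IntermediateField.adjoin E ((s : Set L) \ {b}) with hM
  have hbM : Transcendental M b := by
    have h1 := hs.1.transcendental_adjoin (s := {i : s | (i : L) ≠ b}) (i := ⟨b, hbs⟩) (by simp)
    have h2 : ((↑) : s → L) '' {i : s | (i : L) ≠ b} = (s : Set L) \ {b} := by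
      ext z
      simp [and_comm]
    rw [h2] at h1
    exact fun h => h1 (isAlgebraic_adjoin_iff.1 h)
  -- Separability of L over E(s) is thereby inherited over M(b), as perturbing b over M requires.
  have hle : IntermediateField.adjoin E (s : Set L) ≤ M⟮b⟯.restrictScalars E := by
    rw [adjoin_le_iff]
    intro z hz
    by_cases hzb : z = b
    · subst hzb
      exact mem_adjoin_simple_self M z
    · exact M⟮b⟯.algebraMap_mem (⟨z, subset_adjoin E _ ⟨hz, hzb⟩⟩ : M)
  let : Algebra (IntermediateField.adjoin E (s : Set L)) M⟮b⟯ :=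
    (inclusion hle).toRingHom.toAlgebra
  have : IsScalarTower (IntermediateField.adjoin E (s : Set L)) M⟮b⟯ L :=
    .of_algebraMap_eq fun _ => rfl
  have : Algebra.IsSeparable M⟮b⟯ L :=
    Algebra.isSeparable_tower_top_of_isSeparable (IntermediateField.adjoin E (s : Set L)) M⟮b⟯ L
  have : Algebra.EssFiniteType (IntermediateField.adjoin E (s : Set L)) L := .of_comp E _ L
  have : Algebra.EssFiniteType M⟮b⟯ L :=
    .of_comp (IntermediateField.adjoin E (s : Set L)) M⟮b⟯ L
  have : FiniteDimensional M⟮b⟯ L := Algebra.finite_of_essFiniteType_of_isAlgebraic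
  obtain ⟨τ, hτM, hτb, hτ⟩ := exists_near_hom (M := M) j hbM
    (β := ((fun n : ℕ => j b + HahnSeries.single (n : ℤ) 1 : ℕ → LaurentSeries k) : Ultra k))
    (near_coe.2 ((tendsto_add_X_pow (j b)).mono_left Nat.hyperfilter_le_atTop))
  have hτE : ∀ a : E, τ (algebraMap E L a) = diag k (j (algebraMap E L a)) := fun a =>
    hτM (algebraMap E M a)
  refine ⟨τ, hτE, hτ, fun hτw => ?_⟩
  -- If w were fixed, so would be the ring generated by w and s \ {b}, over which the moved element
  -- b is algebraic.
  refine not_isAlgebraic_of_fixed Subtype.val_injective j τ ?_ hτb hb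
  rintro ⟨a, ha⟩
  change τ a = diag k (j a)
  induction ha using Algebra.adjoin_induction with
  | mem z hz =>
    rcases hz with rfl | hz
    · exact hτw
    · exact hτM ⟨z, subset_adjoin E _ hz⟩
  | algebraMap e => exact hτE e
  | add y z _ _ hy hz => simp only [map_add, hy, hz]
  | mul y z _ _ hy hz => simp only [map_mul, hy, hz]

end Perturbation

/-! ### The contradiction -/

open LaurentSeries IntermediateField

theorem proposition6p21 (k : Type*) [Field k] [PerfectField k] :
    ¬ ∃ f : LaurentSeries k → LaurentSeries k × LaurentSeries k,
      ThreeSorted.IsExistentiallyDefinable f ∧ Function.Surjective f := by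
  rintro ⟨f, ⟨φ, hex, -, hφ⟩, hsurj⟩
  set t := ((PowerSeries.X : PowerSeries k) : LaurentSeries k)
  set y := (PowerSeries.liouville k : LaurentSeries k)
  obtain ⟨x, hx⟩ := hsurj (t, y)
  -- K need not be separable over k(x) when x is a p-th power; fixing the larger field k(x₀) still
  -- fixes x.
  obtain ⟨x₀, hxx₀, hx₀⟩ := exists_mem_adjoin_simple_forall_pow_ne x
  let ρ : LaurentSeries k → LaurentSeries k → LaurentSeries k →
      ThreeSorted.Assignment (LaurentSeries k) k (WithTop ℤ) := fun a b c =>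
    ⟨fun n => if n = 0 then a else if n = 1 then b else if n = 2 then c else 0, 0, 0⟩
  have hρ : ∀ a b c, φ.Realize (ThreeSorted.laurent k) (ρ a b c) ↔ f a = (b, c) := fun a b c =>
    hφ (ρ a b c)
  obtain ⟨S, hS, hS'⟩ := hex.exists_finite_witnesses (ρ x t y) ((hρ _ _ _).2 hx)
  set L := IntermediateField.adjoin k⟮x₀⟯ (S ∪ {t, y}) with hL
  have : Algebra.EssFiniteType k⟮x₀⟯ L :=
    essFiniteType_iff.2 (fg_adjoin_of_finite (hS.union (by simp)))
  obtain ⟨s, hs, hsep⟩ := exists_isTranscendenceBasis_isSeparable_over_adjoin_simple hx₀ L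
  let j : L →+* LaurentSeries k := algebraMap L (LaurentSeries k)
  let x' : L := algebraMap k⟮x₀⟯ L ⟨x, hxx₀⟩
  let t' : L := ⟨t, subset_adjoin _ _ (by simp)⟩
  let y' : L := ⟨y, subset_adjoin _ _ (by simp)⟩
  obtain ⟨w, hw, hwt⟩ : ∃ w : L, Transcendental k⟮x₀⟯ w ∧ (w = t' ∨ w = y') := by
    rcases exists_transcendental_over_adjoin_simple x₀ with h | h
    · exact ⟨t', (transcendental_algebraMap_iff j.injective).1 h, Or.inl rfl⟩
    · exact ⟨y', (transcendental_algebraMap_iff j.injective).1 h, Or.inr rfl⟩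
  obtain ⟨τ, hτE, hτ, hτw⟩ := exists_near_hom_moving j s hs hw
  obtain ⟨u, hu⟩ : ∃ u : ℕ → LaurentSeries k, (u : Ultra k) = τ t' := Quotient.exists_rep _
  obtain ⟨v, hv⟩ : ∃ v : ℕ → LaurentSeries k, (v : Ultra k) = τ y' := Quotient.exists_rep _
  have hreal := hS' L j τ (fun n => ρ x (u n) (v n))
    (fun c => ⟨algebraMap k⟮x₀⟯ L (algebraMap k k⟮x₀⟯ c), algebraMap_eq_C c, by
      rw [hτE]
      exact congrArg (diag k) (algebraMap_eq_C c)⟩) hτ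
    (fun z hz => ⟨⟨z, subset_adjoin _ _ (Or.inl hz)⟩, rfl⟩)
    ⟨fun m => by
      match m with
      | 0 => exact ⟨x', rfl, hτE _⟩
      | 1 => exact ⟨t', rfl, hu.symm⟩
      | 2 => exact ⟨y', rfl, hv.symm⟩
      | m + 3 => exact ⟨0, map_zero j, map_zero τ⟩, fun _ _ => rfl, fun _ _ => rfl⟩
  have hfix : ∀ᶠ n in hyperfilter ℕ, u n = t ∧ v n = y := by
    filter_upwards [hreal] with n hn
    have h1 := (hρ _ _ _).1 hn
    rw [hx, Prod.mk.injEq] at h1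
    exact ⟨h1.1.symm, h1.2.symm⟩
  apply hτw
  rcases hwt with rfl | rfl
  · rw [← hu]
    exact Germ.coe_eq.2 (hfix.mono fun n hn => hn.1)
  · rw [← hv]
    exact Germ.coe_eq.2 (hfix.mono fun n hn => hn.2)
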